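/- Let $A_1,A_2,A_3,A_4$ be the vertices of a (non-degenerate) tetrahedron in $\mathbb{R}^3$, let $B_1,B_2,B_3,B_4,B_{12},B_{34}>0$, and put $S=\frac{B_{12}+B_{34}}{2}$. A *solution* is a pair of points $(O_{12},O_{34})$ of $\mathbb{R}^3$ that minimizes $$f(O_{12},O_{34})=B_1\,A_1O_{12}+B_2\,A_2O_{12}+B_3\,A_3O_{34}+B_4\,A_4O_{34}+S\,O_{12}O_{34}$$ over $\mathbb{R}^3\times\mathbb{R}^3$. It is *non-degenerate* if $O_{12}\neq O_{34}$ and both points lie in the interior of the tetrahedron. For an edge $AA'$ whose ends carry the weights $B,B'$, take Cartesian coordinates in which $A,A'$ lie on the $x$-axis and $x(A)<x(A')$. We say that a point $C$ satisfies the *conditions for* $(A,A';B,B')$ if the following hold, where $\rho=\sqrt{y(C)^2+z(C)^2}$. 0. $S<B+B'$, $B<B'+S$ and $B'<B+S$. Set $\alpha=\arccos\frac{B^2-B'^2-S^2}{2B'S}$, $\alpha'=\arccos\frac{B'^2-B^2-S^2}{2BS}$, $$R=\frac{AA'\cdot B B'}{\sqrt{(B+B'+S)(B+B'-S)(B'+S-B)(B+S-B')}},$$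 and $\beta=\arccos\frac{AA'}{2R}$ if $S^2\le B^2+B'^2$, $\beta=-\arccos\frac{AA'}{2R}$ if $S^2>B^2+B'^2$. 1. $C$ lies outside the right circular half-cone with apex $A$ and half-angle $\gamma=\pi-\alpha$ whose axis is the ray of the $x$-axis from $A$ away from $A'$. That is: if $\gamma<\frac{\pi}{2}$, then $\frac{\rho}{x(A)-x(C)}>\tan\gamma$ whenever $x(C)<x(A)$; if $\gamma\ge\frac{\pi}{2}$, then $x(A)<x(C)$, and moreover, when $\gamma>\frac{\pi}{2}$, $\frac{\rho}{x(A)-x(C)}>\tan\gamma$. 2. $C$ lies outside the right circular half-cone with apex $A'$ and half-angle $\gamma'=\pi-\alpha'$ whose axis is the ray from $A'$ away from $A$. That is: if $\gamma'<\frac{\pi}{2}$, then $\frac{\rho}{x(C)-x(A')}>\tan\gamma'$ whenever $x(A')<x(C)$; if $\gamma'\ge\frac{\pi}{2}$, then $x(C)<x(A')$, and moreover, when $\gamma'>\frac{\pi}{2}$, $\frac{\rho}{x(C)-x(A')}>\tan\gamma'$. 3. $C$ lies outside the surface of revolution swept by a circular arc of radius $R$ over $AA'$: $$(\rho+R\sin\beta)^2+\Big(\tfrac{x(A)+x(A')}{2}-x(C)\Big)^2>R^2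 .$$ **Theorem.** A solution exists. For every solution $(O_{12},O_{34})$ the following are equivalent: (a) there is a non-degenerate solution; (b) $(O_{12},O_{34})$ is non-degenerate; (c) $C=O_{34}$ satisfies the conditions for $(A_1,A_2;B_1,B_2)$ and $C=O_{12}$ satisfies the conditions for $(A_4,A_3;B_4,B_3)$; (d) some point $C$ strictly between $O_{12}$ and $O_{34}$ satisfies both the conditions for $(A_1,A_2;B_1,B_2)$ and those for $(A_4,A_3;B_4,B_3)$; (e) every such point $C$ satisfies both sets of conditions. (If $O_{12}=O_{34}$, the only point "strictly between" them is that point itself.) The coordinate systems for the two edges are chosen separately, and the statement holds for every choice. -/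

import Mathlib

noncomputable section

/-- Three-dimensional Euclidean space. -/
abbrev E3 : Type := EuclideanSpace ℝ (Fin 3)

/-- The weighted length `f(P, Q)` of the network that joins `A₁, A₂` to the node `P`, `A₃, A₄` to the
node `Q`, and `P` to `Q`; the connecting edge has weight `(B₁₂ + B₃₄) / 2`. -/
def steinerLength (A₁ A₂ A₃ A₄ : E3) (B₁ B₂ B₃ B₄ B₁₂ B₃₄ : ℝ) (P Q : E3) : ℝ :=
  B₁ * dist A₁ P + B₂ * dist A₂ P + B₃ * dist A₃ Q + B₄ * dist A₄ Q
    + (B₁₂ + B₃₄) / 2 * dist P Q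

/-- `(P, Q)` solves the weighted Steiner problem: it minimizes `f` among all pairs of points. -/
def IsSteinerPair (A₁ A₂ A₃ A₄ : E3) (B₁ B₂ B₃ B₄ B₁₂ B₃₄ : ℝ) (P Q : E3) : Prop :=
  ∀ P' Q' : E3, steinerLength A₁ A₂ A₃ A₄ B₁ B₂ B₃ B₄ B₁₂ B₃₄ P Q
    ≤ steinerLength A₁ A₂ A₃ A₄ B₁ B₂ B₃ B₄ B₁₂ B₃₄ P' Q'

/-- The nodes `P`, `Q` are non-degenerate: two distinct points in the interior of the tetrahedron. -/
def NondegenerateNodes (A₁ A₂ A₃ A₄ P Q : E3) : Prop :=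
  P ≠ Q ∧ P ∈ interior (convexHull ℝ ({A₁, A₂, A₃, A₄} : Set E3)) ∧
    Q ∈ interior (convexHull ℝ ({A₁, A₂, A₃, A₄} : Set E3))

/-- `e` is a Cartesian coordinate system (point `C` has coordinates `e C 0, e C 1, e C 2`) in which
`A` and `A'` lie on the x-axis and `A` comes before `A'`. -/
def IsAxisFrame (e : E3 ≃ᵢ E3) (A A' : E3) : Prop :=
  e A 1 = 0 ∧ e A 2 = 0 ∧ e A' 1 = 0 ∧ e A' 2 = 0 ∧ e A 0 < e A' 0

/-- The distance `√(y(C)² + z(C)²)` from `C` to the x-axis. -/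
def axisDist (e : E3 ≃ᵢ E3) (C : E3) : ℝ := Real.sqrt ((e C 1) ^ 2 + (e C 2) ^ 2)

/-- `C` lies outside the closed right circular half-cone with half-angle `γ ∈ (0, π)` and axis on the
x-axis; `ρ` is the distance of `C` from the axis, and `d` the coordinate of `C` along the axis, measured
from the apex in the direction in which the half-cone opens. For `γ < π / 2` this is `ρ / d > tan γ` if
`0 < d`, with no condition if `d ≤ 0`; for `γ ≥ π / 2` the half-cone contains the half-space `0 ≤ d`,
and outside of that half-space the inequality is again `ρ / d > tan γ` (void if `γ = π / 2`). -/
def OutsideHalfCone (γ ρ d : ℝ) : Prop :=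
  (γ < Real.pi / 2 → 0 < d → ρ / d > Real.tan γ) ∧
  (Real.pi / 2 ≤ γ → d < 0) ∧
  (Real.pi / 2 < γ → ρ / d > Real.tan γ)

/-- The angle between the edges of weights `v` and `w` at a node in equilibrium whose three edges
have the weights `u`, `v`, `w`. -/
def nodeAngle (u v w : ℝ) : ℝ := Real.arccos ((u ^ 2 - v ^ 2 - w ^ 2) / (2 * v * w))

/-- The circumradius of the triangle that has one side of length `a` and is similar to the triangle with
sides `S, B, B'`, where the side `a` corresponds to `S`. -/
def weightRadius (a B B' S : ℝ) : ℝ :=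
  a * B * B' / Real.sqrt ((B + B' + S) * (B + B' - S) * (B' + S - B) * (B + S - B'))

/-- The angle `β` with `R cos β = a / 2` for which `-R sin β` is the signed height, above the chord of
length `a`, of the centre of the arc over this chord whose inscribed angle is `nodeAngle S B B'`. It is
`arccos (a / (2R))` when the inscribed angle is right or obtuse and `-arccos (a / (2R))` when it is
acute. -/
def arcAngle (a B B' S : ℝ) : ℝ :=
  if S ^ 2 ≤ B ^ 2 + B' ^ 2 then Real.arccos (a / (2 * weightRadius a B B' S))
  else -Real.arccos (a / (2 * weightRadius a B B' S))

/-- The conditions on `C` with respect to the edge `A A'`, whose ends have weights `B`, `B'`; the third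
edge at the node has weight `S`, and `e` is a coordinate system with `A` and `A'` on the x-axis. -/
structure NodeConditions (e : E3 ≃ᵢ E3) (A A' : E3) (B B' S : ℝ) (C : E3) : Prop where
  /-- The three weights are the sides of a non-degenerate triangle, so that the angles and the radius
  below are defined. -/
  triangle : S < B + B' ∧ B < B' + S ∧ B' < B + S
  /-- `C` is outside the half-cone with apex `A` that opens away from `A'`. -/
  cone_left : OutsideHalfCone (Real.pi - nodeAngle B B' S) (axisDist e C) (e A 0 - e C 0)
  /-- `C` is outside the half-cone with apex `A'` that opens away from `A`. -/
  cone_right : OutsideHalfCone (Real.pi - nodeAngle B' B S) (axisDist e C) (e C 0 - e A' 0)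
  /-- `C` is outside the surface swept by an arc over `A A'` that revolves about the line `A A'`. -/
  surface :
    (axisDist e C + weightRadius (dist A A') B B' S * Real.sin (arcAngle (dist A A') B B' S)) ^ 2
      + ((e A 0 + e A' 0) / 2 - e C 0) ^ 2 > weightRadius (dist A A') B B' S ^ 2

end

/-! The conditions describe a three-point problem. Put weights `B`, `B'`, `S` on `A`, `A'`, `C`. A
vertex minimizes the weighted sum of distances iff its weight is at least the length of the
resultant of the two other weighted unit vectors. With the law of cosines, the two cone conditions
say that this fails at `A` and at `A'`, and the surface condition that it fails at `C`. So the
conditions hold iff `C` is off the line `AA'` and no vertex is a minimizer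
(`nodeConditions_iff_vertices_not_min`).

Let `(P, Q)` be a solution. For every `C` on the segment `PQ`, the node `P` minimizes the sum for
`A₁, A₂, C`, by the triangle inequality through `C` (`IsSteinerPair.weberSum_min`). If the nodes are
non-degenerate and `C ≠ P`, then `P` is no vertex, and since minimizers for a noncollinear triple
are unique, no vertex is a minimizer: the conditions hold at `C`. Conversely, if they hold at some
`C` on the segment, then `P` is no vertex, and the balance of forces at `P` makes it a strict convex
combination of `A₁, A₂, C`, hence of `A₁, A₂, Q`. The same holds for `Q` with `A₄, A₃, P`. Solving
these two relations in each barycentric coordinate shows that both nodes are interior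
(`mem_interior_of_strict_combinations`).

That one non-degenerate solution forces all others to agree with it follows from convexity at
midpoints (`IsSteinerPair.left_unique`). -/

/-- The weighted sum of the distances to three points. -/
def weberSum {E : Type*} [NormedAddCommGroup E] (A₁ A₂ A₃ : E) (w₁ w₂ w₃ : ℝ) (X : E) : ℝ :=
  w₁ * dist A₁ X + w₂ * dist A₂ X + w₃ * dist A₃ X

lemma weberSum_rotate {E : Type*} [NormedAddCommGroup E] (A₁ A₂ A₃ : E) (w₁ w₂ w₃ : ℝ) (X : E) :
    weberSum A₂ A₃ A₁ w₂ w₃ w₁ X = weberSum A₁ A₂ A₃ w₁ w₂ w₃ X := by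
  unfold weberSum; ring

/-! ### The weighted three-point problem -/

section WeberSum

variable {E : Type*} [NormedAddCommGroup E] [InnerProductSpace ℝ E]

/-- A quadratic upper bound for the norm near a nonzero vector. -/
lemma norm_sub_smul_le {a : E} (ha : a ≠ 0) (v : E) (t : ℝ) :
    ‖a - t • v‖ ≤ ‖a‖ - t * inner ℝ (‖a‖⁻¹ • a) v + t ^ 2 * (‖v‖ ^ 2 / (2 * ‖a‖)) := by
  have h0 : 0 < ‖a‖ := norm_pos_iff.2 ha
  have h1 : ‖a - t • v‖ ^ 2 = ‖a‖ ^ 2 - 2 * (t * inner ℝ a v) + t ^ 2 * ‖v‖ ^ 2 := by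
    rw [norm_sub_sq_real, inner_smul_right, norm_smul, mul_pow, Real.norm_eq_abs, sq_abs]
  -- The bound is `(x² + y²) / (2x)` with `x = ‖a‖` and `y = ‖a - t • v‖`, which is at least `y`
  -- because `(x - y)² ≥ 0`.
  have h2 : ‖a‖ - t * inner ℝ (‖a‖⁻¹ • a) v + t ^ 2 * (‖v‖ ^ 2 / (2 * ‖a‖))
      = (‖a‖ ^ 2 + ‖a - t • v‖ ^ 2) / (2 * ‖a‖) := by
    rw [h1, real_inner_smul_left]
    field_simp
    ring
  rw [h2, le_div_iff₀ (by positivity)]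
  nlinarith [sq_nonneg (‖a‖ - ‖a - t • v‖)]

lemma nonneg_of_forall_pos_add_mul {c K : ℝ} (h : ∀ t > 0, 0 ≤ c + t * K) : 0 ≤ c := by
  by_contra! hc
  have hK : 0 < |K| + 1 := by positivity
  have h1 := h (-c / 2 / (|K| + 1)) (by have : 0 < -c := by linarith
                                        positivity)
  have h2 : -c / 2 / (|K| + 1) * K ≤ -c / 2 := by
    rw [div_mul_eq_mul_div, div_le_iff₀ hK]
    nlinarith [le_abs_self K]
  linarith

/-- First-order condition at a minimizer of a weighted sum of distances. -/
lemma norm_sum_smul_le_of_forall_le {ι : Type*} (s : Finset ι) (w : ι → ℝ) (A : ι → E) (P : E)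
    (w₀ : ℝ) (hw : ∀ i ∈ s, 0 ≤ w i) (hA : ∀ i ∈ s, A i ≠ P) (hw₀ : 0 ≤ w₀)
    (h : ∀ X, ∑ i ∈ s, w i * dist (A i) P ≤ w₀ * dist P X + ∑ i ∈ s, w i * dist (A i) X) :
    ‖∑ i ∈ s, (w i * ‖A i - P‖⁻¹) • (A i - P)‖ ≤ w₀ := by
  set v := ∑ i ∈ s, (w i * ‖A i - P‖⁻¹) • (A i - P) with hv
  -- Minimality is tested along the resultant `v` itself, the direction of steepest descent; letting
  -- `t → 0` leaves `‖v‖² ≤ w₀ ‖v‖`.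
  have key : ∀ t > 0, 0 ≤ (w₀ * ‖v‖ - ‖v‖ ^ 2)
      + t * ∑ i ∈ s, w i * (‖v‖ ^ 2 / (2 * ‖A i - P‖)) := by
    intro t ht
    have h1 := h (P + t • v)
    have h2 : ∑ i ∈ s, w i * dist (A i) (P + t • v) ≤ ∑ i ∈ s, w i * (‖A i - P‖
        - t * inner ℝ (‖A i - P‖⁻¹ • (A i - P)) v + t ^ 2 * (‖v‖ ^ 2 / (2 * ‖A i - P‖))) := by
      refine Finset.sum_le_sum fun i hi => mul_le_mul_of_nonneg_left ?_ (hw i hi)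
      rw [dist_eq_norm, ← sub_sub]
      exact norm_sub_smul_le (sub_ne_zero.2 (hA i hi)) v t
    have h3 : ∑ i ∈ s, w i * inner ℝ (‖A i - P‖⁻¹ • (A i - P)) v = ‖v‖ ^ 2 := by
      rw [← real_inner_self_eq_norm_sq]
      nth_rw 2 [hv]
      rw [sum_inner]
      refine Finset.sum_congr rfl fun i _ => ?_
      rw [mul_smul, real_inner_smul_left (F := E) _ _ (w i)]
    have h4 : ∑ i ∈ s, w i * (‖A i - P‖
        - t * inner ℝ (‖A i - P‖⁻¹ • (A i - P)) v + t ^ 2 * (‖v‖ ^ 2 / (2 * ‖A i - P‖)))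
        = ∑ i ∈ s, w i * dist (A i) P - t * ‖v‖ ^ 2
          + t ^ 2 * ∑ i ∈ s, w i * (‖v‖ ^ 2 / (2 * ‖A i - P‖)) := by
      rw [← h3, Finset.mul_sum, Finset.mul_sum, ← Finset.sum_sub_distrib, ← Finset.sum_add_distrib]
      refine Finset.sum_congr rfl fun i _ => ?_
      rw [dist_eq_norm]
      ring
    have h5 : dist P (P + t • v) = t * ‖v‖ := by
      rw [dist_self_add_right, norm_smul, Real.norm_of_nonneg ht.le]
    rw [h5] at h1
    have h6 : 0 ≤ t * ((w₀ * ‖v‖ - ‖v‖ ^ 2)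
        + t * ∑ i ∈ s, w i * (‖v‖ ^ 2 / (2 * ‖A i - P‖))) := by
      nlinarith
    exact nonneg_of_mul_nonneg_right h6 ht
  have h7 := nonneg_of_forall_pos_add_mul key
  rcases (norm_nonneg v).eq_or_lt with h0 | h0
  · rw [← h0]; exact hw₀
  · nlinarith

/-- Cauchy–Schwarz: the convex function `dist A` lies above its tangent at `P`. -/
lemma dist_sub_inner_le {A P : E} (X : E) (h : A ≠ P) :
    dist A P - inner ℝ (‖A - P‖⁻¹ • (A - P)) (X - P) ≤ dist A X := by
  have h0 : 0 < ‖A - P‖ := norm_pos_iff.2 (sub_ne_zero.2 h)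
  have h1 := real_inner_le_norm (A - P) (A - X)
  have h2 : inner ℝ (A - P) (A - X) = ‖A - P‖ ^ 2 - inner ℝ (A - P) (X - P) := by
    rw [← real_inner_self_eq_norm_sq, ← inner_sub_right]
    congr 1; abel
  rw [real_inner_smul_left, dist_eq_norm, dist_eq_norm, sub_le_iff_le_add, inv_mul_eq_div,
    ← sub_le_iff_le_add', le_div_iff₀ h0]
  nlinarith

/-- A vertex minimizes the weighted sum of distances iff its weight dominates the resultant of the
other two weights. -/
lemma weberSum_vertex_min_iff_norm {P Q R : E} {w₁ w₂ w₃ : ℝ} (h₁ : 0 ≤ w₁) (h₂ : 0 ≤ w₂)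
    (h₃ : 0 ≤ w₃) (hQ : Q ≠ P) (hR : R ≠ P) :
    (∀ X, weberSum P Q R w₁ w₂ w₃ P ≤ weberSum P Q R w₁ w₂ w₃ X) ↔
      ‖(w₂ * ‖Q - P‖⁻¹) • (Q - P) + (w₃ * ‖R - P‖⁻¹) • (R - P)‖ ≤ w₁ := by
  constructor
  · intro h
    have := norm_sum_smul_le_of_forall_le Finset.univ ![w₂, w₃] ![Q, R] P w₁
      (by simp [Fin.forall_fin_two, h₂, h₃]) (by simp [Fin.forall_fin_two, hQ, hR]) h₁
      (fun X => by have := h X; simp [weberSum] at this ⊢; linarith)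
    simpa using this
  · intro h X
    have hq := mul_le_mul_of_nonneg_left (dist_sub_inner_le X hQ) h₂
    have hr := mul_le_mul_of_nonneg_left (dist_sub_inner_le X hR) h₃
    have hc := real_inner_le_norm
      ((w₂ * ‖Q - P‖⁻¹) • (Q - P) + (w₃ * ‖R - P‖⁻¹) • (R - P)) (X - P)
    have hm := mul_le_mul_of_nonneg_right h (norm_nonneg (X - P))
    rw [inner_add_left, mul_smul, mul_smul, real_inner_smul_left (F := E) _ _ w₂,
      real_inner_smul_left (F := E) _ _ w₃] at hc
    rw [mul_smul, mul_smul] at hm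
    have hd : dist P X = ‖X - P‖ := by rw [dist_comm, dist_eq_norm]
    simp only [weberSum, dist_self, hd]
    linarith

lemma weberSum_vertex_min_iff {P Q R : E} {w₁ w₂ w₃ : ℝ} (h₁ : 0 ≤ w₁) (h₂ : 0 ≤ w₂)
    (h₃ : 0 ≤ w₃) (hQ : Q ≠ P) (hR : R ≠ P) :
    (∀ X, weberSum P Q R w₁ w₂ w₃ P ≤ weberSum P Q R w₁ w₂ w₃ X) ↔
      w₂ * w₃ * (dist P Q ^ 2 + dist P R ^ 2 - dist Q R ^ 2)
        ≤ (w₁ ^ 2 - w₂ ^ 2 - w₃ ^ 2) * (dist P Q * dist P R) := by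
  rw [weberSum_vertex_min_iff_norm h₁ h₂ h₃ hQ hR]
  have hq : 0 < ‖Q - P‖ := norm_pos_iff.2 (sub_ne_zero.2 hQ)
  have hr : 0 < ‖R - P‖ := norm_pos_iff.2 (sub_ne_zero.2 hR)
  have e1 : dist Q R ^ 2 = ‖Q - P‖ ^ 2 - 2 * inner ℝ (Q - P) (R - P) + ‖R - P‖ ^ 2 := by
    rw [← norm_sub_sq_real, dist_eq_norm]
    congr 2; abel
  have e2 : ‖(w₂ * ‖Q - P‖⁻¹) • (Q - P) + (w₃ * ‖R - P‖⁻¹) • (R - P)‖ ^ 2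
      = w₂ ^ 2 + w₃ ^ 2 + 2 * w₂ * w₃ * inner ℝ (Q - P) (R - P) / (‖Q - P‖ * ‖R - P‖) := by
    rw [norm_add_sq_real, norm_smul, norm_smul, real_inner_smul_left, real_inner_smul_right,
      Real.norm_of_nonneg (by positivity), Real.norm_of_nonneg (by positivity)]
    field_simp
    ring
  rw [← abs_of_nonneg (norm_nonneg (_ + _)), ← abs_of_nonneg h₁, ← sq_le_sq, abs_of_nonneg h₁, e2,
    e1, dist_comm P Q, dist_comm P R, dist_eq_norm Q P, dist_eq_norm R P, ← le_sub_iff_add_le',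
    div_le_iff₀ (by positivity)]
  constructor <;> intro h <;> linarith

/-- A minimizer of the weighted sum of distances that is not a vertex is a strict convex combination
of the vertices. -/
lemma weberSum_min_strict_combination {A₁ A₂ A₃ P : E} {w₁ w₂ w₃ : ℝ} (h₁ : 0 < w₁) (h₂ : 0 < w₂)
    (h₃ : 0 < w₃) (hA₁ : A₁ ≠ P) (hA₂ : A₂ ≠ P) (hA₃ : A₃ ≠ P)
    (h : ∀ X, weberSum A₁ A₂ A₃ w₁ w₂ w₃ P ≤ weberSum A₁ A₂ A₃ w₁ w₂ w₃ X) :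
    ∃ a b c : ℝ, 0 < a ∧ 0 < b ∧ 0 < c ∧ a • (A₁ - P) + b • (A₂ - P) + c • (A₃ - P) = 0 := by
  -- As `P` is no vertex, all three terms are smooth there; `w₀ = 0` makes the resultant vanish.
  have := norm_sum_smul_le_of_forall_le Finset.univ ![w₁, w₂, w₃] ![A₁, A₂, A₃] P 0
      (by simp [Fin.forall_fin_succ, h₁.le, h₂.le, h₃.le])
      (by simp [Fin.forall_fin_succ, hA₁, hA₂, hA₃]) le_rfl
      (fun X => by have := h X; simpa [weberSum, Fin.sum_univ_three] using this)
  have h0 := norm_le_zero_iff.1 this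
  have p₁ : 0 < ‖A₁ - P‖ := norm_pos_iff.2 (sub_ne_zero.2 hA₁)
  have p₂ : 0 < ‖A₂ - P‖ := norm_pos_iff.2 (sub_ne_zero.2 hA₂)
  have p₃ : 0 < ‖A₃ - P‖ := norm_pos_iff.2 (sub_ne_zero.2 hA₃)
  exact ⟨_, _, _, mul_pos h₁ (inv_pos.2 p₁), mul_pos h₂ (inv_pos.2 p₂), mul_pos h₃ (inv_pos.2 p₃),
    by simpa [Fin.sum_univ_three] using h0⟩

lemma dist_midpoint_le_half_add (A P P' : E) :
    dist A (midpoint ℝ P P') ≤ (dist A P + dist A P') / 2 := by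
  have := dist_midpoint_midpoint_le A A P P'
  simpa using this

/-- Equality case of the convexity of the distance to a point. -/
lemma mem_line_of_dist_midpoint {A P P' : E} (hne : P ≠ P')
    (h : (dist A P + dist A P') / 2 ≤ dist A (midpoint ℝ P P')) : A ∈ line[ℝ, P, P'] := by
  have hm : A - midpoint ℝ P P' = (2⁻¹ : ℝ) • ((A - P) + (A - P')) := by
    rw [midpoint_eq_smul_add, invOf_eq_inv]
    module
  have h1 : ‖(A - P) + (A - P')‖ = ‖A - P‖ + ‖A - P'‖ := by
    refine le_antisymm (norm_add_le _ _) ?_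
    rw [dist_eq_norm, dist_eq_norm, dist_eq_norm, hm, norm_smul] at h
    norm_num at h
    linarith
  have h2 : SameRay ℝ (A - P) (A - P') := sameRay_iff_norm_add.2 h1
  rw [SameRay.sameRay_comm] at h2
  -- `SameRay` lets either vector vanish; a relation with nonnegative coefficients, not both zero,
  -- covers all its cases.
  obtain ⟨a, b, ha, hb, hab, e⟩ : ∃ a b : ℝ, 0 ≤ a ∧ 0 ≤ b ∧ a + b ≠ 0 ∧
      a • (A - P') = b • (A - P) := by
    rcases h2 with h2 | h2 | ⟨a, b, ha, hb, e⟩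
    · exact ⟨1, 0, zero_le_one, le_rfl, by norm_num, by simp [h2]⟩
    · exact ⟨0, 1, le_rfl, zero_le_one, by norm_num, by simp [h2]⟩
    · exact ⟨a, b, ha.le, hb.le, by positivity, e⟩
  have hab' : a - b ≠ 0 := by
    intro h3
    have : a = b := by linarith
    subst this
    have ha0 : a ≠ 0 := by rintro rfl; simp at hab
    have := smul_right_injective E ha0 e
    exact hne (by simpa using this.symm)
  have e' : (a - b) • A = a • P' - b • P := by
    rw [sub_smul, sub_eq_sub_iff_sub_eq_sub]
    simpa [smul_sub] using e
  have e2 : A = (a - b)⁻¹ • (a • P' - b • P) := by rw [← e', inv_smul_smul₀ hab']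
  have : A = AffineMap.lineMap P P' (a / (a - b)) := by
    rw [AffineMap.lineMap_apply_module, show 1 - a / (a - b) = -((a - b)⁻¹ * b) by
      field_simp; ring, div_eq_inv_mul]
    nth_rw 1 [e2]
    module
  rw [this]
  exact AffineMap.lineMap_mem_affineSpan_pair _ _ _

/-- Minimizers of the weighted sum of distances to three noncollinear points are unique. -/
lemma weberSum_min_unique {A₁ A₂ A₃ P P' : E} {w₁ w₂ w₃ : ℝ} (h₁ : 0 < w₁) (h₂ : 0 < w₂)
    (h₃ : 0 < w₃) (hc : ¬ Collinear ℝ {A₁, A₂, A₃})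
    (h : ∀ X, weberSum A₁ A₂ A₃ w₁ w₂ w₃ P ≤ weberSum A₁ A₂ A₃ w₁ w₂ w₃ X)
    (h' : ∀ X, weberSum A₁ A₂ A₃ w₁ w₂ w₃ P' ≤ weberSum A₁ A₂ A₃ w₁ w₂ w₃ X) : P = P' := by
  by_contra hne
  have m₁ := dist_midpoint_le_half_add A₁ P P'
  have m₂ := dist_midpoint_le_half_add A₂ P P'
  have m₃ := dist_midpoint_le_half_add A₃ P P'
  have k := h (midpoint ℝ P P')
  have k' := h' (midpoint ℝ P P')
  simp only [weberSum] at k k'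
  refine hc (collinear_triple_of_mem_affineSpan_pair (mem_line_of_dist_midpoint hne ?_)
    (mem_line_of_dist_midpoint hne ?_) (mem_line_of_dist_midpoint hne ?_))
  all_goals
    by_contra! hlt
  · nlinarith [mul_lt_mul_of_pos_left hlt h₁, mul_le_mul_of_nonneg_left m₂ h₂.le,
      mul_le_mul_of_nonneg_left m₃ h₃.le]
  · nlinarith [mul_lt_mul_of_pos_left hlt h₂, mul_le_mul_of_nonneg_left m₁ h₁.le,
      mul_le_mul_of_nonneg_left m₃ h₃.le]
  · nlinarith [mul_lt_mul_of_pos_left hlt h₃, mul_le_mul_of_nonneg_left m₁ h₁.le,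
      mul_le_mul_of_nonneg_left m₂ h₂.le]

end WeberSum

/-! ### Trigonometry of the cones and the arc -/

/-- If `(d, ρ)` has polar angle `φ` and `(c, s) = (cos γ, sin γ)` with both angles in `(0, π)`, this
says `sin (φ - γ) > 0 ↔ cos φ < cos γ`. -/
lemma mul_lt_mul_iff_lt_mul_sqrt {s c ρ d : ℝ} (hs : 0 < s) (hρ : 0 < ρ) (hsc : s ^ 2 + c ^ 2 = 1) :
    d * s < ρ * c ↔ d < c * Real.sqrt (ρ ^ 2 + d ^ 2) := by
  have hr : 0 < Real.sqrt (ρ ^ 2 + d ^ 2) := Real.sqrt_pos.2 (by positivity)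
  have hr2 := Real.sq_sqrt (show 0 ≤ ρ ^ 2 + d ^ 2 by positivity)
  set r := Real.sqrt (ρ ^ 2 + d ^ 2)
  have key : (ρ * c) ^ 2 - (d * s) ^ 2 = (c * r) ^ 2 - d ^ 2 := by
    rw [mul_pow c r, hr2]
    linear_combination (-d ^ 2) * hsc
  rcases lt_or_ge 0 c with hc | hc
  · rcases le_or_gt d 0 with hd | hd
    · have := mul_pos hρ hc
      have := mul_pos hc hr
      have := mul_nonneg (neg_nonneg.2 hd) hs.le
      constructor <;> intro <;> linarith
    · rw [← sq_lt_sq₀ (by positivity) (by positivity), ← sq_lt_sq₀ hd.le (by positivity)]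
      constructor <;> intro <;> linarith
  · have h1 : ρ * c ≤ 0 := mul_nonpos_of_nonneg_of_nonpos hρ.le hc
    have h2 : c * r ≤ 0 := mul_nonpos_of_nonpos_of_nonneg hc hr.le
    rcases le_or_gt 0 d with hd | hd
    · have := mul_nonneg hd hs.le
      constructor <;> intro <;> linarith
    · have h3 : 0 < -(d * s) := by nlinarith
      rw [← neg_lt_neg_iff, ← sq_lt_sq₀ (neg_nonneg.2 h1) h3.le,
        ← neg_lt_neg_iff (b := d), ← sq_lt_sq₀ (neg_nonneg.2 h2) (neg_nonneg.2 hd.le),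
        neg_sq, neg_sq, neg_sq, neg_sq]
      constructor <;> intro <;> linarith

lemma outsideHalfCone_iff_sin_lt_cos {γ ρ d : ℝ} (h0 : 0 < γ) (hπ : γ < Real.pi) (hρ : 0 < ρ) :
    OutsideHalfCone γ ρ d ↔ d * Real.sin γ < ρ * Real.cos γ := by
  have hs : 0 < Real.sin γ := Real.sin_pos_of_pos_of_lt_pi h0 hπ
  unfold OutsideHalfCone
  rw [Real.tan_eq_sin_div_cos]
  rcases lt_trichotomy γ (Real.pi / 2) with h | h | h
  · have hc : 0 < Real.cos γ := Real.cos_pos_of_mem_Ioo ⟨by linarith, h⟩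
    simp only [h, h.not_ge, h.le.not_gt, forall_true_left, false_imp_iff, and_true]
    rcases le_or_gt d 0 with hd | hd
    · have := mul_pos hρ hc
      have := mul_nonneg (neg_nonneg.2 hd) hs.le
      refine ⟨fun _ => by linarith, fun _ hd' => absurd hd' hd.not_gt⟩
    · simp only [hd, forall_true_left, gt_iff_lt]
      rw [div_lt_div_iff₀ hc hd, mul_comm (Real.sin γ)]
  · simp [h]
  · have hc : Real.cos γ < 0 := Real.cos_neg_of_pi_div_two_lt_of_lt h (by linarith)
    simp only [h, h.le, h.le.not_gt, forall_true_left, false_imp_iff, true_and, gt_iff_lt]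
    rcases lt_or_ge d 0 with hd | hd
    · simp only [hd, true_and]
      rw [lt_div_iff_of_neg hd, div_mul_eq_mul_div, lt_div_iff_of_neg hc, mul_comm (Real.sin γ)]
    · have := mul_pos_of_neg_of_neg hc (neg_lt_zero.2 hρ)
      have := mul_nonneg hd hs.le
      exact ⟨fun h => absurd h.1 hd.not_gt, fun h => by linarith⟩

lemma OutsideHalfCone.nonpos {γ d : ℝ} (h0 : 0 < γ) (h : OutsideHalfCone γ 0 d) : d ≤ 0 := by
  by_contra! hd
  rcases lt_or_ge γ (Real.pi / 2) with hγ | hγ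
  · have h1 := h.1 hγ hd
    have := Real.tan_pos_of_pos_of_lt_pi_div_two h0 hγ
    simp at h1
    linarith
  · exact (h.2.1 hγ).not_ge hd.le

/-- The cosine in `nodeAngle` is a proper cosine when the weights are the sides of a triangle. -/
lemma nodeAngle_cos_mem {u v w : ℝ} (hv : 0 < v) (hw : 0 < w) (h₁ : u < v + w) (h₂ : v < w + u)
    (h₃ : w < u + v) :
    -1 < (u ^ 2 - v ^ 2 - w ^ 2) / (2 * v * w) ∧ (u ^ 2 - v ^ 2 - w ^ 2) / (2 * v * w) < 1 := by
  rw [lt_div_iff₀ (by positivity), div_lt_iff₀ (by positivity)]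
  constructor <;> nlinarith

lemma outsideHalfCone_nodeAngle_iff {u v w ρ d : ℝ} (hv : 0 < v) (hw : 0 < w) (h₁ : u < v + w)
    (h₂ : v < w + u) (h₃ : w < u + v) (hρ : 0 < ρ) :
    OutsideHalfCone (Real.pi - nodeAngle u v w) ρ d ↔
      (u ^ 2 - v ^ 2 - w ^ 2) * Real.sqrt (ρ ^ 2 + d ^ 2) < 2 * v * w * (-d) := by
  obtain ⟨l, r⟩ := nodeAngle_cos_mem hv hw h₁ h₂ h₃
  unfold nodeAngle
  set k := (u ^ 2 - v ^ 2 - w ^ 2) / (2 * v * w) with hk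
  have hk' : u ^ 2 - v ^ 2 - w ^ 2 = k * (2 * v * w) := by rw [hk]; field_simp
  have hpos := Real.arccos_lt_pi.2 l
  have hlt := Real.arccos_pos.2 r
  rw [outsideHalfCone_iff_sin_lt_cos (by linarith) (by linarith) hρ, Real.sin_pi_sub,
    Real.cos_pi_sub, Real.sin_arccos, Real.cos_arccos l.le r.le,
    mul_lt_mul_iff_lt_mul_sqrt (Real.sqrt_pos.2 (by nlinarith)) hρ
      (by rw [Real.sq_sqrt (by nlinarith)]; ring), hk']
  have hvw : 0 < 2 * v * w := by positivity
  rw [show k * (2 * v * w) * Real.sqrt (ρ ^ 2 + d ^ 2)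
    = 2 * v * w * (k * Real.sqrt (ρ ^ 2 + d ^ 2)) by ring, mul_lt_mul_iff_right₀ hvw]
  constructor <;> intro <;> linarith

lemma pi_sub_nodeAngle_pos {u v w : ℝ} (hv : 0 < v) (hw : 0 < w) (h₁ : u < v + w)
    (h₂ : v < w + u) (h₃ : w < u + v) : 0 < Real.pi - nodeAngle u v w :=
  sub_pos.2 (Real.arccos_lt_pi.2 (nodeAngle_cos_mem hv hw h₁ h₂ h₃).1)

/-- Radius and signed centre height of the arc in terms of the cosine `c` of the angle opposite to
`S` in the triangle with sides `B`, `B'`, `S`. -/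
lemma exists_weightRadius_arcAngle {a B B' S : ℝ} (ha : 0 < a) (hB : 0 < B) (hB' : 0 < B')
    (h₁ : S < B + B') (h₂ : B < B' + S) (h₃ : B' < B + S) :
    ∃ s c : ℝ, 0 < s ∧ s ^ 2 + c ^ 2 = 1 ∧ B ^ 2 + B' ^ 2 - S ^ 2 = 2 * B * B' * c ∧
      weightRadius a B B' S = a / (2 * s) ∧ Real.sin (arcAngle a B B' S) = c := by
  obtain ⟨l, r⟩ := nodeAngle_cos_mem hB hB' h₁ (by linarith) (by linarith)
  set k := (S ^ 2 - B ^ 2 - B' ^ 2) / (2 * B * B') with hk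
  have hk' : S ^ 2 - B ^ 2 - B' ^ 2 = k * (2 * B * B') := by rw [hk]; field_simp
  have h1k : 0 < 1 - k ^ 2 := by nlinarith
  have hs : 0 < Real.sqrt (1 - k ^ 2) := Real.sqrt_pos.2 h1k
  have hs2 := Real.sq_sqrt h1k.le
  have hR : weightRadius a B B' S = a / (2 * Real.sqrt (1 - k ^ 2)) := by
    -- Heron's formula: both sides are 16 times the squared area of the triangle of weights.
    have : (B + B' + S) * (B + B' - S) * (B' + S - B) * (B + S - B')
        = (2 * B * B') ^ 2 * (1 - k ^ 2) := by
      have : (2 * B * B') ^ 2 * (1 - k ^ 2) = (2 * B * B') ^ 2 - (k * (2 * B * B')) ^ 2 := by ring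
      rw [this, ← hk']; ring
    rw [weightRadius, this, Real.sqrt_mul (by positivity), Real.sqrt_sq (by positivity)]
    field_simp
  refine ⟨Real.sqrt (1 - k ^ 2), -k, hs, by rw [hs2]; ring, by linarith, hR, ?_⟩
  have hcos : a / (2 * weightRadius a B B' S) = Real.sqrt (1 - k ^ 2) := by
    rw [hR]; field_simp
  have hsin : Real.sin (Real.arccos (Real.sqrt (1 - k ^ 2))) = |k| := by
    rw [Real.sin_arccos, hs2, sub_sub_cancel, Real.sqrt_sq_eq_abs]
  rw [arcAngle, hcos]
  have hBB : 0 < 2 * B * B' := by positivity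
  split_ifs with h
  · rw [hsin, abs_of_nonpos]
    by_contra! hc
    nlinarith [mul_pos hc hBB]
  · rw [Real.sin_neg, hsin, abs_of_nonneg]
    by_contra! hc
    nlinarith [mul_pos (neg_pos.2 hc) hBB]

/-- If `u ≥ v + w`, then `u² - v² - w² ≥ 2vw`, while `p² + q² - r² ≤ 2pq` since a cosine is at most
1. -/
lemma lt_add_of_angle_lt {u v w p q r : ℝ} (hv : 0 < v) (hw : 0 < w) (hp : 0 < p) (hq : 0 < q)
    (hr : |p - q| ≤ r)
    (h : (u ^ 2 - v ^ 2 - w ^ 2) * (p * q) < v * w * (p ^ 2 + q ^ 2 - r ^ 2)) : u < v + w := by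
  by_contra! hc
  have h1 : (p - q) ^ 2 ≤ r ^ 2 := by rw [← sq_abs]; gcongr
  have h2 : 2 * (v * w) ≤ u ^ 2 - v ^ 2 - w ^ 2 := by nlinarith
  have h3 := mul_le_mul_of_nonneg_right h2 (mul_pos hp hq).le
  have h4 := mul_le_mul_of_nonneg_left h1 (mul_pos hv hw).le
  linarith

/-! ### The conditions as non-minimality of the vertices -/

/-- `NodeConditions` in terms of distances: the point is off the axis, and none of the three points
`A`, `A'`, `C` carries a weight that dominates the resultant of the two others. -/
lemma nodeConditions_iff {e : E3 ≃ᵢ E3} {A A' C : E3} {B B' S : ℝ} (he : IsAxisFrame e A A')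
    (hB : 0 < B) (hB' : 0 < B') (hS : 0 < S) :
    NodeConditions e A A' B B' S C ↔ 0 < axisDist e C ∧
      (B ^ 2 - B' ^ 2 - S ^ 2) * (dist A A' * dist A C)
        < B' * S * (dist A A' ^ 2 + dist A C ^ 2 - dist A' C ^ 2) ∧
      (B' ^ 2 - S ^ 2 - B ^ 2) * (dist A' C * dist A' A)
        < S * B * (dist A' C ^ 2 + dist A' A ^ 2 - dist C A ^ 2) ∧
      (S ^ 2 - B ^ 2 - B' ^ 2) * (dist C A * dist C A')
        < B * B' * (dist C A ^ 2 + dist C A' ^ 2 - dist A A' ^ 2) := by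
  obtain ⟨y1, z1, y2, z2, hx⟩ := he
  have hρ2 : axisDist e C ^ 2 = (e C 1) ^ 2 + (e C 2) ^ 2 := Real.sq_sqrt (by positivity)
  have hρ0 : 0 ≤ axisDist e C := Real.sqrt_nonneg _
  have dAC : dist A C = Real.sqrt (axisDist e C ^ 2 + (e A 0 - e C 0) ^ 2) := by
    rw [← e.dist_eq, EuclideanSpace.dist_eq, hρ2]
    simp only [Fin.sum_univ_three, Real.dist_eq, sq_abs, y1, z1]
    congr 1; ring
  have dA'C : dist A' C = Real.sqrt (axisDist e C ^ 2 + (e C 0 - e A' 0) ^ 2) := by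
    rw [← e.dist_eq, EuclideanSpace.dist_eq, hρ2]
    simp only [Fin.sum_univ_three, Real.dist_eq, sq_abs, y2, z2]
    congr 1; ring
  have dAA' : dist A A' = e A' 0 - e A 0 := by
    rw [← e.dist_eq, EuclideanSpace.dist_eq]
    simp only [Fin.sum_univ_three, Real.dist_eq, sq_abs, y1, y2, z1, z2]
    rw [← Real.sqrt_sq (sub_pos.2 hx).le]
    congr 1; ring
  rw [dist_comm A' A, dist_comm C A, dist_comm C A']
  have ha : 0 < dist A A' := by rw [dAA']; linarith
  have sAC : dist A C ^ 2 = axisDist e C ^ 2 + (e A 0 - e C 0) ^ 2 := by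
    rw [dAC, Real.sq_sqrt (by positivity)]
  have sA'C : dist A' C ^ 2 = axisDist e C ^ 2 + (e C 0 - e A' 0) ^ 2 := by
    rw [dA'C, Real.sq_sqrt (by positivity)]
  have hm : e A 0 = e A' 0 - dist A A' := by rw [dAA']; ring
  set ρ := axisDist e C with hρdef
  set a := dist A A' with hadef
  have tri : (0 < ρ ∧ (B ^ 2 - B' ^ 2 - S ^ 2) * (a * dist A C)
        < B' * S * (a ^ 2 + dist A C ^ 2 - dist A' C ^ 2) ∧
      (B' ^ 2 - S ^ 2 - B ^ 2) * (dist A' C * a)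
        < S * B * (dist A' C ^ 2 + a ^ 2 - dist A C ^ 2) ∧
      (S ^ 2 - B ^ 2 - B' ^ 2) * (dist A C * dist A' C)
        < B * B' * (dist A C ^ 2 + dist A' C ^ 2 - a ^ 2)) →
      S < B + B' ∧ B < B' + S ∧ B' < B + S := by
    rintro ⟨hρ, c1, c2, c3⟩
    have pos1 : 0 < dist A C := by rw [dAC]; positivity
    have pos2 : 0 < dist A' C := by rw [dA'C]; positivity
    refine ⟨lt_add_of_angle_lt hB hB' pos1 pos2 ?_ c3, lt_add_of_angle_lt hB' hS ha pos1 ?_ c1,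
      (lt_add_of_angle_lt hS hB pos2 ha ?_ c2).trans_eq (add_comm _ _)⟩
    · exact abs_dist_sub_le _ _ _
    · rw [hadef, dist_comm A A', dist_comm A C]; exact abs_dist_sub_le _ _ _
    · rw [hadef, dist_comm A' C, dist_comm A C]; exact abs_dist_sub_le _ _ _
  have main : S < B + B' ∧ B < B' + S ∧ B' < B + S → 0 < ρ →
      ((OutsideHalfCone (Real.pi - nodeAngle B B' S) ρ (e A 0 - e C 0) ↔
          (B ^ 2 - B' ^ 2 - S ^ 2) * (a * dist A C)
            < B' * S * (a ^ 2 + dist A C ^ 2 - dist A' C ^ 2)) ∧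
       (OutsideHalfCone (Real.pi - nodeAngle B' B S) ρ (e C 0 - e A' 0) ↔
          (B' ^ 2 - S ^ 2 - B ^ 2) * (dist A' C * a)
            < S * B * (dist A' C ^ 2 + a ^ 2 - dist A C ^ 2)) ∧
       ((ρ + weightRadius a B B' S * Real.sin (arcAngle a B B' S)) ^ 2
          + ((e A 0 + e A' 0) / 2 - e C 0) ^ 2 > weightRadius a B B' S ^ 2 ↔
          (S ^ 2 - B ^ 2 - B' ^ 2) * (dist A C * dist A' C)
            < B * B' * (dist A C ^ 2 + dist A' C ^ 2 - a ^ 2))) := by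
    rintro ⟨t1, t2, t3⟩ hρ
    refine ⟨?_, ?_, ?_⟩
    · rw [outsideHalfCone_nodeAngle_iff hB' hS t2 (by linarith) (by linarith) hρ, ← dAC,
        ← mul_lt_mul_iff_right₀ ha, sAC, sA'C, hm]
      refine iff_of_eq (congrArg₂ _ ?_ ?_) <;> ring
    · rw [outsideHalfCone_nodeAngle_iff hB hS t3 (by linarith) (by linarith) hρ, ← dA'C,
        ← mul_lt_mul_iff_right₀ ha, sAC, sA'C, hm]
      refine iff_of_eq (congrArg₂ _ ?_ ?_) <;> ring
    · obtain ⟨s, c, hs, hsc, hc, hR, hsin⟩ := exists_weightRadius_arcAngle ha hB hB' t1 t2 t3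
      -- `D` is the inner product of `A - C` and `A' - C`, and `a * ρ` is twice the area of `A A'
      -- C`, so the point `(D, aρ)` has the angle at `C` as its polar angle.
      set D := ρ ^ 2 + (e A 0 - e C 0) * (e A' 0 - e C 0) with hD
      have hprod : dist A C * dist A' C = Real.sqrt ((a * ρ) ^ 2 + (-D) ^ 2) := by
        rw [dAC, dA'C, ← Real.sqrt_mul (by positivity), hD, hm]
        congr 1; ring
      have hiff := mul_lt_mul_iff_lt_mul_sqrt (d := -D) hs (mul_pos ha hρ) hsc
      rw [← hprod] at hiff
      have e1 : (ρ + weightRadius a B B' S * Real.sin (arcAngle a B B' S)) ^ 2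
          + ((e A 0 + e A' 0) / 2 - e C 0) ^ 2 - weightRadius a B B' S ^ 2
          = (a * ρ * c - -D * s) / s := by
        rw [hsin, hR, hD, hm]
        have hc2 : c ^ 2 = 1 - s ^ 2 := by linarith
        field_simp
        ring_nf
        rw [hc2]
        ring
      have e2 : B * B' * (dist A C ^ 2 + dist A' C ^ 2 - a ^ 2) = 2 * B * B' * D := by
        rw [sAC, sA'C, hD, hm]; ring
      have e3 : S ^ 2 - B ^ 2 - B' ^ 2 = -(2 * B * B' * c) := by linarith
      have hBB : 0 < 2 * B * B' := by positivity
      rw [gt_iff_lt, ← sub_pos, e1, div_pos_iff_of_pos_right hs, sub_pos, hiff, e2, e3,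
        show -(2 * B * B' * c) * (dist A C * dist A' C)
          = 2 * B * B' * -(c * (dist A C * dist A' C)) by ring, mul_lt_mul_iff_right₀ hBB]
      constructor <;> intro <;> linarith
  constructor
  · rintro ⟨ht, h1, h2, h3⟩
    -- On the axis, the cone conditions put `C` between `A` and `A'`, while the surface condition
    -- puts it farther than `a / 2` from their midpoint.
    have hρ : 0 < ρ := by
      refine hρ0.lt_of_ne fun h0 => ?_
      rw [← hρdef, ← h0] at h1 h2
      rw [← hρdef, ← hadef, ← h0] at h3
      obtain ⟨t1, t2, t3⟩ := ht
      have d1 := h1.nonpos (pi_sub_nodeAngle_pos hB' hS t2 (by linarith) (by linarith))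
      have d2 := h2.nonpos (pi_sub_nodeAngle_pos hB hS t3 (by linarith) (by linarith))
      obtain ⟨s, c, hs, hsc, hc, hR, hsin⟩ := exists_weightRadius_arcAngle ha hB hB' t1 t2 t3
      rw [hsin, hR] at h3
      have : (a / (2 * s)) ^ 2 - (0 + a / (2 * s) * c) ^ 2 = a ^ 2 / 4 := by
        field_simp
        linear_combination (-4 * a ^ 2) * hsc
      have h4 : ((e A 0 + e A' 0) / 2 - e C 0) ^ 2 > a ^ 2 / 4 := by linarith
      rw [hm] at h4 d1
      nlinarith
    obtain ⟨m1, m2, m3⟩ := main ht hρ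
    exact ⟨hρ, m1.1 h1, m2.1 h2, m3.1 h3⟩
  · intro h
    have ht := tri h
    obtain ⟨hρ, h1, h2, h3⟩ := h
    obtain ⟨m1, m2, m3⟩ := main ht hρ
    exact ⟨ht, m1.2 h1, m2.2 h2, m3.2 h3⟩

/-- A point off the line `A A'` is off the axis of a frame for `A`, `A'`. -/
lemma axisDist_pos {e : E3 ≃ᵢ E3} {A A' C : E3} (he : IsAxisFrame e A A')
    (hC : C ∉ line[ℝ, A, A']) : 0 < axisDist e C := by
  obtain ⟨y1, z1, y2, z2, hx⟩ := he
  refine (Real.sqrt_nonneg _).lt_of_ne fun h0 => hC ?_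
  have h1 : (e C 1) ^ 2 + (e C 2) ^ 2 = 0 :=
    (Real.sqrt_eq_zero (by positivity)).1 h0.symm
  have hy : e C 1 = 0 := by nlinarith [sq_nonneg (e C 1), sq_nonneg (e C 2)]
  have hz : e C 2 = 0 := by nlinarith [sq_nonneg (e C 1), sq_nonneg (e C 2)]
  have hne : e A' 0 - e A 0 ≠ 0 := (sub_pos.2 hx).ne'
  have h2 : e C = AffineMap.lineMap (e A) (e A') ((e C 0 - e A 0) / (e A' 0 - e A 0)) := by
    ext i
    fin_cases i
    · simp [AffineMap.lineMap_apply, hne]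
    · simp [AffineMap.lineMap_apply, y1, y2, hy]
    · simp [AffineMap.lineMap_apply, z1, z2, hz]
  have h3 : e (AffineMap.lineMap A A' ((e C 0 - e A 0) / (e A' 0 - e A 0)))
      = AffineMap.lineMap (e A) (e A') ((e C 0 - e A 0) / (e A' 0 - e A 0)) :=
    e.toRealAffineIsometryEquiv.toAffineEquiv.toAffineMap.apply_lineMap A A' _
  rw [e.injective (h2.trans h3.symm)]
  exact AffineMap.lineMap_mem_affineSpan_pair _ _ _

lemma nodeConditions_iff_vertices_not_min {e : E3 ≃ᵢ E3} {A A' C : E3} {B B' S : ℝ}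
    (he : IsAxisFrame e A A') (hB : 0 < B) (hB' : 0 < B') (hS : 0 < S) :
    NodeConditions e A A' B B' S C ↔ 0 < axisDist e C ∧
      ∀ V ∈ ({A, A', C} : Set E3), ¬ ∀ X, weberSum A A' C B B' S V ≤ weberSum A A' C B B' S X := by
  rw [nodeConditions_iff he hB hB' hS]
  refine and_congr_right fun hρ => ?_
  have hAA' : A' ≠ A := by
    rintro rfl
    exact lt_irrefl _ he.2.2.2.2
  have hCA : C ≠ A := by
    rintro rfl
    simp [axisDist, he.1, he.2.1] at hρ
  have hCA' : C ≠ A' := by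
    rintro rfl
    simp [axisDist, he.2.2.1, he.2.2.2.1] at hρ
  have h2 := weberSum_vertex_min_iff hB'.le hS.le hB.le hCA' hAA'.symm
  have h3 := weberSum_vertex_min_iff hS.le hB.le hB'.le hCA.symm hCA'.symm
  simp only [weberSum_rotate A A' C] at h2
  simp only [← weberSum_rotate C A A'] at h3
  simp only [Set.mem_insert_iff, Set.mem_singleton_iff, forall_eq_or_imp, forall_eq]
  rw [weberSum_vertex_min_iff hB.le hB'.le hS.le hAA' hCA, h2, h3, not_le, not_le, not_le]

/-- The conditions hold at `C` off the line `A A'` when the three-point problem for `A`, `A'`, `C` has a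
minimizer that is none of these points. -/
lemma nodeConditions_of_min {e : E3 ≃ᵢ E3} {A A' C P : E3} {B B' S : ℝ}
    (he : IsAxisFrame e A A') (hB : 0 < B) (hB' : 0 < B') (hS : 0 < S) (hC : C ∉ line[ℝ, A, A'])
    (hPA : A ≠ P) (hPA' : A' ≠ P) (hPC : C ≠ P)
    (hmin : ∀ X, weberSum A A' C B B' S P ≤ weberSum A A' C B B' S X) :
    NodeConditions e A A' B B' S C := by
  have hne : A ≠ A' := by
    rintro rfl
    exact lt_irrefl _ he.2.2.2.2
  have hcol : ¬ Collinear ℝ {A, A', C} := fun h =>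
    hC (h.mem_affineSpan_of_mem_of_ne (by simp) (by simp) (by simp) hne)
  rw [nodeConditions_iff_vertices_not_min he hB hB' hS]
  refine ⟨axisDist_pos he hC, fun V hV h => ?_⟩
  have hVP := weberSum_min_unique hB hB' hS hcol h hmin
  rcases hV with rfl | rfl | rfl <;> contradiction

/-! ### The two-node problem -/

section SteinerPair

variable {A₁ A₂ A₃ A₄ P Q : E3} {B₁ B₂ B₃ B₄ B₁₂ B₃₄ : ℝ}

/-- Reversing all four vertices produces the order `A₄, A₃` of the second set of conditions. -/
lemma IsSteinerPair.swap (h : IsSteinerPair A₁ A₂ A₃ A₄ B₁ B₂ B₃ B₄ B₁₂ B₃₄ P Q) :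
    IsSteinerPair A₄ A₃ A₂ A₁ B₄ B₃ B₂ B₁ B₁₂ B₃₄ Q P := by
  intro P' Q'
  have := h Q' P'
  simp only [steinerLength] at this ⊢
  rw [dist_comm Q P, dist_comm P' Q']
  linarith

lemma exists_isSteinerPair (A₁ A₂ A₃ A₄ : E3) (hB₁ : 0 < B₁) (hB₂ : 0 < B₂) (hB₃ : 0 < B₃)
    (hB₄ : 0 < B₄) (hB₁₂ : 0 < B₁₂) (hB₃₄ : 0 < B₃₄) :
    ∃ P Q, IsSteinerPair A₁ A₂ A₃ A₄ B₁ B₂ B₃ B₄ B₁₂ B₃₄ P Q := by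
  let f : E3 × E3 → ℝ := fun z => steinerLength A₁ A₂ A₃ A₄ B₁ B₂ B₃ B₄ B₁₂ B₃₄ z.1 z.2
  have hf : Continuous f := by
    unfold f steinerLength
    fun_prop
  -- One positive weight per node already makes `f` coercive.
  set m := min B₁ B₄ with hm
  have hm0 : 0 < m := lt_min hB₁ hB₄
  have hlow : ∀ z : E3 × E3, m * ‖z‖ + -(m * (‖A₁‖ + ‖A₄‖)) ≤ f z := by
    rintro ⟨P, Q⟩
    have h1 : ‖P‖ ≤ ‖A₁‖ + dist A₁ P := by
      rw [dist_eq_norm, norm_sub_rev]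
      exact norm_le_norm_add_norm_sub' P A₁
    have h2 : ‖Q‖ ≤ ‖A₄‖ + dist A₄ Q := by
      rw [dist_eq_norm, norm_sub_rev]
      exact norm_le_norm_add_norm_sub' Q A₄
    have h3 : ‖(P, Q)‖ ≤ ‖A₁‖ + ‖A₄‖ + (dist A₁ P + dist A₄ Q) := by
      rw [Prod.norm_def]
      refine max_le ?_ ?_
      · linarith [norm_nonneg A₄, dist_nonneg (x := A₄) (y := Q)]
      · linarith [norm_nonneg A₁, dist_nonneg (x := A₁) (y := P)]
    have h4 : m * dist A₁ P ≤ B₁ * dist A₁ P := by gcongr; exact min_le_left _ _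
    have h5 : m * dist A₄ Q ≤ B₄ * dist A₄ Q := by gcongr; exact min_le_right _ _
    have h6 : 0 ≤ B₂ * dist A₂ P := by positivity
    have h7 : 0 ≤ B₃ * dist A₃ Q := by positivity
    have h8 : 0 ≤ (B₁₂ + B₃₄) / 2 * dist P Q := by positivity
    have h9 := mul_le_mul_of_nonneg_left h3 hm0.le
    simp only [f, steinerLength]
    linarith
  have ht : Filter.Tendsto f (Filter.cocompact _) Filter.atTop :=
    Filter.tendsto_atTop_mono hlow (Filter.tendsto_atTop_add_const_right _ _
      (tendsto_norm_cocompact_atTop.const_mul_atTop hm0))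
  obtain ⟨z, hz⟩ := hf.exists_forall_le ht
  exact ⟨z.1, z.2, fun P' Q' => hz (P', Q')⟩

/-- A node of an optimal network also solves the three-point problem for any point on the
connecting edge. -/
lemma IsSteinerPair.weberSum_min (hB₁₂ : 0 < B₁₂) (hB₃₄ : 0 < B₃₄)
    (h : IsSteinerPair A₁ A₂ A₃ A₄ B₁ B₂ B₃ B₄ B₁₂ B₃₄ P Q) {C : E3} (hC : C ∈ segment ℝ P Q)
    (X : E3) : weberSum A₁ A₂ C B₁ B₂ ((B₁₂ + B₃₄) / 2) P
      ≤ weberSum A₁ A₂ C B₁ B₂ ((B₁₂ + B₃₄) / 2) X := by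
  have h1 := h X Q
  have h2 := dist_add_dist_of_mem_segment hC
  have h3 := mul_le_mul_of_nonneg_left (dist_triangle X C Q)
    (show 0 ≤ (B₁₂ + B₃₄) / 2 by positivity)
  simp only [steinerLength, weberSum] at h1 ⊢
  rw [← h2, mul_add] at h1
  rw [mul_add] at h3
  rw [dist_comm C P, dist_comm C X]
  linarith

/-- At the midpoint of two solutions every term must be affine. If `P ≠ P'`, equality for `A₁` and
`A₂` puts both on the line `PP'`, so `P` lies on `A₁A₂`. -/
lemma IsSteinerPair.left_unique (hB₁ : 0 < B₁) (hB₂ : 0 < B₂) (hB₃ : 0 < B₃)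
    (hB₄ : 0 < B₄) (hB₁₂ : 0 < B₁₂) (hB₃₄ : 0 < B₃₄) (hA : A₁ ≠ A₂) (hP : P ∉ line[ℝ, A₁, A₂])
    (h : IsSteinerPair A₁ A₂ A₃ A₄ B₁ B₂ B₃ B₄ B₁₂ B₃₄ P Q) {P' Q' : E3}
    (h' : IsSteinerPair A₁ A₂ A₃ A₄ B₁ B₂ B₃ B₄ B₁₂ B₃₄ P' Q') : P = P' := by
  by_contra hne
  have k := h (midpoint ℝ P P') (midpoint ℝ Q Q')
  have k' := h' (midpoint ℝ P P') (midpoint ℝ Q Q')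
  simp only [steinerLength] at k k'
  have m₁ := dist_midpoint_le_half_add A₁ P P'
  have m₂ := dist_midpoint_le_half_add A₂ P P'
  have m₃ := mul_le_mul_of_nonneg_left (dist_midpoint_le_half_add A₃ Q Q') hB₃.le
  have m₄ := mul_le_mul_of_nonneg_left (dist_midpoint_le_half_add A₄ Q Q') hB₄.le
  have m₅ := mul_le_mul_of_nonneg_left (dist_midpoint_midpoint_le P P' Q Q')
    (show 0 ≤ (B₁₂ + B₃₄) / 2 by positivity)
  have l₁ : A₁ ∈ line[ℝ, P, P'] := by
    refine mem_line_of_dist_midpoint hne ?_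
    by_contra! hlt
    have := mul_lt_mul_of_pos_left hlt hB₁
    have := mul_le_mul_of_nonneg_left m₂ hB₂.le
    linarith
  have l₂ : A₂ ∈ line[ℝ, P, P'] := by
    refine mem_line_of_dist_midpoint hne ?_
    by_contra! hlt
    have := mul_lt_mul_of_pos_left hlt hB₂
    have := mul_le_mul_of_nonneg_left m₁ hB₁.le
    linarith
  exact hP ((collinear_triple_of_mem_affineSpan_pair l₁ l₂
    (left_mem_affineSpan_pair ℝ P P')).mem_affineSpan_of_mem_of_ne (by simp) (by simp) (by simp) hA)

/-- If some point `C` of the connecting edge satisfies the conditions, then the node `P` is a strict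
convex combination of `A₁`, `A₂` and the other node. -/
lemma IsSteinerPair.strict_combination (hB₁ : 0 < B₁) (hB₂ : 0 < B₂) (hB₁₂ : 0 < B₁₂)
    (hB₃₄ : 0 < B₃₄) {e : E3 ≃ᵢ E3} (he : IsAxisFrame e A₁ A₂)
    (h : IsSteinerPair A₁ A₂ A₃ A₄ B₁ B₂ B₃ B₄ B₁₂ B₃₄ P Q) {C : E3} (hC : C ∈ segment ℝ P Q)
    (hc : NodeConditions e A₁ A₂ B₁ B₂ ((B₁₂ + B₃₄) / 2) C) :
    P ≠ Q ∧ ∃ a b c : ℝ, 0 < a ∧ 0 < b ∧ 0 < c ∧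
      a • (A₁ - P) + b • (A₂ - P) + c • (Q - P) = 0 := by
  have hS : 0 < (B₁₂ + B₃₄) / 2 := by positivity
  have hmin := h.weberSum_min hB₁₂ hB₃₄ hC
  obtain ⟨-, hv⟩ := (nodeConditions_iff_vertices_not_min he hB₁ hB₂ hS).1 hc
  have h1 : A₁ ≠ P := by rintro rfl; exact hv _ (by simp) hmin
  have h2 : A₂ ≠ P := by rintro rfl; exact hv _ (by simp) hmin
  have h3 : C ≠ P := by rintro rfl; exact hv _ (by simp) hmin
  obtain ⟨a, b, c, ha, hb, hc', habc⟩ := weberSum_min_strict_combination hB₁ hB₂ hS h1 h2 h3 hmin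
  -- With `C = P + s (Q - P)`, the coefficient `c` of `C - P` becomes `c * s` on `Q - P`.
  rw [segment_eq_image'] at hC
  obtain ⟨s, ⟨hs, -⟩, rfl⟩ := hC
  have hs : 0 < s := hs.lt_of_ne (by rintro rfl; simp at h3)
  refine ⟨by rintro rfl; simp at h3, a, b, c * s, ha, hb, mul_pos hc' hs, ?_⟩
  simpa [smul_smul] using habc

end SteinerPair

/-! ### Interior points in barycentric coordinates -/

section Barycentric

/-- The vertices of a nondegenerate tetrahedron as an affine basis. -/
def tetrahedronBasis (A : Fin 4 → E3) (hA : AffineIndependent ℝ A) : AffineBasis (Fin 4) ℝ E3 where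
  toFun := A
  ind' := hA
  tot' := by rw [hA.affineSpan_eq_top_iff_card_eq_finrank_add_one]; simp

lemma mem_interior_tetrahedron_iff {A₁ A₂ A₃ A₄ : E3}
    (hA : AffineIndependent ℝ ![A₁, A₂, A₃, A₄]) {X : E3} :
    X ∈ interior (convexHull ℝ ({A₁, A₂, A₃, A₄} : Set E3)) ↔
      ∀ i, 0 < (tetrahedronBasis _ hA).coord i X := by
  have : ({A₁, A₂, A₃, A₄} : Set E3) = Set.range (tetrahedronBasis _ hA) := by
    change _ = Set.range ![A₁, A₂, A₃, A₄]
    ext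
    simp [Matrix.range_cons]
    tauto
  rw [this, AffineBasis.interior_convexHull, Set.mem_ofPred_eq]

lemma AffineBasis.notMem_line_of_coord_pos {ι V : Type*} [AddCommGroup V] [Module ℝ V]
    (b : AffineBasis ι ℝ V) {i j k : ι} (hi : k ≠ i) (hj : k ≠ j) {X : V} (hX : 0 < b.coord k X) :
    X ∉ line[ℝ, b i, b j] := by
  intro h
  obtain ⟨t, rfl⟩ := mem_affineSpan_pair_iff_exists_lineMap_eq.1 h
  rw [AffineMap.apply_lineMap, b.coord_apply_ne hi, b.coord_apply_ne hj] at hX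
  simp at hX

lemma AffineMap.apply_strict_combination {V : Type*} [AddCommGroup V] [Module ℝ V] (φ : V →ᵃ[ℝ] ℝ)
    {A A' P Q : V} {a b c : ℝ} (h : a • (A - P) + b • (A' - P) + c • (Q - P) = 0) :
    (a + b + c) * φ P = a * φ A + b * φ A' + c * φ Q := by
  have h1 := congrArg φ.linear h
  have h2 (X : V) : φ.linear (X - P) = φ X - φ P := φ.linearMap_vsub X P
  simp only [map_add, map_smul, h2, map_zero, smul_eq_mul] at h1
  linarith

/-- Cramer's rule for a diagonally dominant system. Here `p`, `q` are one barycentric coordinate of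
the two nodes, and `x`, `y` the contributions of the vertices, of which exactly one is nonzero in
the application. -/
lemma pos_of_mul_eq_add_mul {p q r r' c c' x y : ℝ} (hc : 0 < c) (hc' : 0 < c') (hr : c < r)
    (hr' : c' < r') (hx : 0 ≤ x) (hy : 0 ≤ y) (hxy : 0 < x + y) (h : r * p = x + c * q)
    (h' : r' * q = y + c' * p) : 0 < p ∧ 0 < q := by
  have hD : 0 < r * r' - c * c' := by nlinarith
  have e1 : (r * r' - c * c') * p = r' * x + c * y := by linear_combination r' * h + c * h'
  have e2 : (r * r' - c * c') * q = r * y + c' * x := by linear_combination r * h' + c' * h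
  have hr0 : 0 < r := hc.trans hr
  have hr0' : 0 < r' := hc'.trans hr'
  have k1 : 0 < r' * x + c * y := by
    rcases hx.eq_or_lt with rfl | hx
    · have : 0 < y := by linarith
      positivity
    · positivity
  have k2 : 0 < r * y + c' * x := by
    rcases hx.eq_or_lt with rfl | hx
    · have : 0 < y := by linarith
      positivity
    · positivity
  exact ⟨pos_of_mul_pos_right (e1 ▸ k1) hD.le, pos_of_mul_pos_right (e2 ▸ k2) hD.le⟩

/-- Two points, each a strict convex combination of the other one and of two vertices of the
tetrahedron, are interior points. -/
lemma mem_interior_of_strict_combinations {A₁ A₂ A₃ A₄ P Q : E3}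
    (hA : AffineIndependent ℝ ![A₁, A₂, A₃, A₄]) {a b c a' b' c' : ℝ}
    (ha : 0 < a) (hb : 0 < b) (hc : 0 < c) (ha' : 0 < a') (hb' : 0 < b') (hc' : 0 < c')
    (h : a • (A₁ - P) + b • (A₂ - P) + c • (Q - P) = 0)
    (h' : a' • (A₄ - Q) + b' • (A₃ - Q) + c' • (P - Q) = 0) :
    P ∈ interior (convexHull ℝ ({A₁, A₂, A₃, A₄} : Set E3)) ∧
      Q ∈ interior (convexHull ℝ ({A₁, A₂, A₃, A₄} : Set E3)) := by
  rw [mem_interior_tetrahedron_iff hA, mem_interior_tetrahedron_iff hA, ← forall_and]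
  set β := tetrahedronBasis _ hA
  intro i
  have v (k : Fin 4) : β.coord i (![A₁, A₂, A₃, A₄] k) = if i = k then 1 else 0 :=
    β.coord_apply i k
  have v1 := v 0
  have v2 := v 1
  have v3 := v 2
  have v4 := v 3
  simp only [Matrix.cons_val] at v1 v2 v3 v4
  have e := (β.coord i).apply_strict_combination h
  have e' := (β.coord i).apply_strict_combination h'
  rw [v1, v2] at e
  rw [v3, v4] at e'
  refine pos_of_mul_eq_add_mul hc hc' (by linarith) (by linarith) ?_ ?_ ?_ e e'
  all_goals fin_cases i <;> simp <;> positivity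

end Barycentric

/-! ### The equivalences -/

theorem theorem2
    (A₁ A₂ A₃ A₄ : E3) (hA : AffineIndependent ℝ ![A₁, A₂, A₃, A₄])
    (B₁ B₂ B₃ B₄ B₁₂ B₃₄ : ℝ)
    (hB₁ : 0 < B₁) (hB₂ : 0 < B₂) (hB₃ : 0 < B₃) (hB₄ : 0 < B₄) (hB₁₂ : 0 < B₁₂) (hB₃₄ : 0 < B₃₄)
    (e₁₂ e₄₃ : E3 ≃ᵢ E3) (he₁₂ : IsAxisFrame e₁₂ A₁ A₂) (he₄₃ : IsAxisFrame e₄₃ A₄ A₃) :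
    (∃ O₁₂ O₃₄ : E3, IsSteinerPair A₁ A₂ A₃ A₄ B₁ B₂ B₃ B₄ B₁₂ B₃₄ O₁₂ O₃₄) ∧
    ∀ O₁₂ O₃₄ : E3, IsSteinerPair A₁ A₂ A₃ A₄ B₁ B₂ B₃ B₄ B₁₂ B₃₄ O₁₂ O₃₄ →
      List.TFAE [
        ∃ P Q : E3, IsSteinerPair A₁ A₂ A₃ A₄ B₁ B₂ B₃ B₄ B₁₂ B₃₄ P Q ∧
          NondegenerateNodes A₁ A₂ A₃ A₄ P Q,
        NondegenerateNodes A₁ A₂ A₃ A₄ O₁₂ O₃₄,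
        NodeConditions e₁₂ A₁ A₂ B₁ B₂ ((B₁₂ + B₃₄) / 2) O₃₄ ∧
          NodeConditions e₄₃ A₄ A₃ B₄ B₃ ((B₁₂ + B₃₄) / 2) O₁₂,
        ∃ C ∈ openSegment ℝ O₁₂ O₃₄,
          NodeConditions e₁₂ A₁ A₂ B₁ B₂ ((B₁₂ + B₃₄) / 2) C ∧
          NodeConditions e₄₃ A₄ A₃ B₄ B₃ ((B₁₂ + B₃₄) / 2) C,
        ∀ C ∈ openSegment ℝ O₁₂ O₃₄,
          NodeConditions e₁₂ A₁ A₂ B₁ B₂ ((B₁₂ + B₃₄) / 2) C ∧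
          NodeConditions e₄₃ A₄ A₃ B₄ B₃ ((B₁₂ + B₃₄) / 2) C] := by
  refine ⟨exists_isSteinerPair A₁ A₂ A₃ A₄ hB₁ hB₂ hB₃ hB₄ hB₁₂ hB₃₄, fun P Q h => ?_⟩
  have hS : 0 < (B₁₂ + B₃₄) / 2 := by positivity
  set T := interior (convexHull ℝ ({A₁, A₂, A₃, A₄} : Set E3)) with hT
  have off₁₂ {X : E3} (hX : X ∈ T) : X ∉ line[ℝ, A₁, A₂] :=
    (tetrahedronBasis _ hA).notMem_line_of_coord_pos (i := 0) (j := 1) (k := 2) (by decide)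
      (by decide) ((mem_interior_tetrahedron_iff hA).1 hX 2)
  have off₄₃ {X : E3} (hX : X ∈ T) : X ∉ line[ℝ, A₄, A₃] :=
    (tetrahedronBasis _ hA).notMem_line_of_coord_pos (i := 3) (j := 2) (k := 0) (by decide)
      (by decide) ((mem_interior_tetrahedron_iff hA).1 hX 0)
  have ne_left {A A' X : E3} (hX : X ∉ line[ℝ, A, A']) : A ≠ X := by
    rintro rfl
    exact hX (left_mem_affineSpan_pair ℝ A A')
  have ne_right {A A' X : E3} (hX : X ∉ line[ℝ, A, A']) : A' ≠ X := by
    rintro rfl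
    exact hX (right_mem_affineSpan_pair ℝ A A')
  have seg : NondegenerateNodes A₁ A₂ A₃ A₄ P Q → segment ℝ P Q ⊆ T := fun hn =>
    (convex_convexHull ℝ _).interior.segment_subset hn.2.1 hn.2.2
  have cond₁₂ (hn : NondegenerateNodes A₁ A₂ A₃ A₄ P Q) {C : E3} (hC : C ∈ segment ℝ P Q)
      (hCP : C ≠ P) : NodeConditions e₁₂ A₁ A₂ B₁ B₂ ((B₁₂ + B₃₄) / 2) C :=
    nodeConditions_of_min he₁₂ hB₁ hB₂ hS (off₁₂ (seg hn hC)) (ne_left (off₁₂ hn.2.1))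
      (ne_right (off₁₂ hn.2.1)) hCP (h.weberSum_min hB₁₂ hB₃₄ hC)
  have cond₄₃ (hn : NondegenerateNodes A₁ A₂ A₃ A₄ P Q) {C : E3} (hC : C ∈ segment ℝ P Q)
      (hCQ : C ≠ Q) : NodeConditions e₄₃ A₄ A₃ B₄ B₃ ((B₁₂ + B₃₄) / 2) C :=
    nodeConditions_of_min he₄₃ hB₄ hB₃ hS (off₄₃ (seg hn hC)) (ne_left (off₄₃ hn.2.2))
      (ne_right (off₄₃ hn.2.2)) hCQ (h.swap.weberSum_min hB₁₂ hB₃₄ (segment_symm ℝ P Q ▸ hC))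
  have nondeg {C C' : E3} (hC : C ∈ segment ℝ P Q) (hC' : C' ∈ segment ℝ P Q)
      (hc : NodeConditions e₁₂ A₁ A₂ B₁ B₂ ((B₁₂ + B₃₄) / 2) C)
      (hc' : NodeConditions e₄₃ A₄ A₃ B₄ B₃ ((B₁₂ + B₃₄) / 2) C') :
      NondegenerateNodes A₁ A₂ A₃ A₄ P Q := by
    obtain ⟨hPQ, a, b, c, ha, hb, hc, habc⟩ :=
      h.strict_combination hB₁ hB₂ hB₁₂ hB₃₄ he₁₂ hC hc
    obtain ⟨-, a', b', c', ha', hb', hc', habc'⟩ :=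
      h.swap.strict_combination hB₄ hB₃ hB₁₂ hB₃₄ he₄₃ (segment_symm ℝ P Q ▸ hC') hc'
    exact ⟨hPQ, mem_interior_of_strict_combinations hA ha hb hc ha' hb' hc' habc habc'⟩
  tfae_have 2 → 1 := fun hn => ⟨P, Q, h, hn⟩
  tfae_have 1 → 2 := by
    rintro ⟨P', Q', h', hn⟩
    have h₁₂ : A₁ ≠ A₂ := fun h => by simpa using hA.injective (a₁ := 0) (a₂ := 1) h
    have h₄₃ : A₄ ≠ A₃ := fun h => by simpa using hA.injective (a₁ := 3) (a₂ := 2) h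
    have hP := h'.left_unique hB₁ hB₂ hB₃ hB₄ hB₁₂ hB₃₄ h₁₂ (off₁₂ hn.2.1) h
    have hQ := h'.swap.left_unique hB₄ hB₃ hB₂ hB₁ hB₁₂ hB₃₄ h₄₃ (off₄₃ hn.2.2) h.swap
    rwa [← hP, ← hQ]
  tfae_have 2 → 3 := fun hn =>
    ⟨cond₁₂ hn (right_mem_segment ℝ P Q) hn.1.symm, cond₄₃ hn (left_mem_segment ℝ P Q) hn.1⟩
  tfae_have 3 → 2 := fun hc =>
    nondeg (right_mem_segment ℝ P Q) (left_mem_segment ℝ P Q) hc.1 hc.2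
  tfae_have 2 → 5 := by
    intro hn C hC
    have hC' := openSegment_subset_segment ℝ P Q hC
    refine ⟨cond₁₂ hn hC' ?_, cond₄₃ hn hC' ?_⟩
    · rintro rfl
      exact hn.1 (left_mem_openSegment_iff.1 hC)
    · rintro rfl
      exact hn.1 (right_mem_openSegment_iff.1 hC)
  -- The open segment contains the midpoint even if `P = Q`, so (e) is never vacuous.
  tfae_have 5 → 4 := fun hc => by
    have hC : midpoint ℝ P Q ∈ openSegment ℝ P Q := midpoint_mem_openSegment P Q
    exact ⟨_, hC, hc _ hC⟩
  tfae_have 4 → 2 := by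
    rintro ⟨C, hC, hc, hc'⟩
    have hC' := openSegment_subset_segment ℝ P Q hC
    exact nondeg hC' hC' hc hc'
  tfae_finish
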